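/- Let $p$ be a prime and $P$ a finite $p$-group. A saturated fusion system on a subgroup $S\le P$ is a category $\mathcal F$ whose objects are the subgroups of $S$, whose morphisms are injective group homomorphisms (with the usual composition), which contains all inclusions and all maps induced by conjugation by elements of $S$, in which every morphism $\varphi:Q\to R$ induces an isomorphism $Q\to\varphi(Q)$ that lies in $\mathcal F$ together with its inverse, and which satisfies the Sylow axiom ($\mathrm{Aut}_S(S)$ is a Sylow $p$-subgroup of $\mathrm{Aut}_{\mathcal F}(S)$) and the extension axiom (if $\varphi\in\mathrm{Hom}_{\mathcal F}(Q,S)$ and $\varphi(Q)$ is fully $\mathcal F$-normalized, then $\varphi$ extends to a morphism in $\mathrm{Hom}_{\mathcal F}(N_\varphi,S)$, where $N_\varphi$ is the inverse image in $N_S(Q)$ of $\mathrm{Aut}_S(Q)\cap\varphi^{-1}\mathrm{Aut}_S(\varphi(Q))\varphi$). For a group $G\ge S$, $\mathcal F_S(G)$ is the category whose morphisms are the maps between subgroups of $S$ induced by conjugation by elements of $G$. A saturated fusion system $\mathcal F$ on $P$ is extremely sparse if $\mathcal F\ne\mathcal F_P(P)$ and every saturated subsystem $\mathcal G\neq\mathcal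 F$ of $\mathcal F$ on any subgroup $Q\le P$ equals $\mathcal F_Q(Q)$. The focal subgroup of $\mathcal F$ is $[P,\mathcal F]=\langle x^{-1}\varphi(x)\mid x\in P,\ \varphi\in\mathrm{Hom}_{\mathcal F}(\langle x\rangle,P)\rangle$. The hyperfocal subgroup is $\mathfrak{hyp}(\mathcal F)=\langle x^{-1}\alpha(x)\mid x\in Q\le P,\ \alpha\in O^p(\mathrm{Aut}_{\mathcal F}(Q))\rangle$, where $O^p(K)$ is the smallest normal subgroup of $p$-power index of a finite group $K$. A saturated subsystem $\mathcal G$ of $\mathcal F$ on $T\le P$ has $p$-power index if $T\ge\mathfrak{hyp}(\mathcal F)$ and $\mathrm{Aut}_{\mathcal G}(Q)\ge O^p(\mathrm{Aut}_{\mathcal F}(Q))$ for all $Q\le T$; $O^p(\mathcal F)$ is the unique saturated subsystem of $p$-power index of $\mathcal F$ on $\mathfrak{hyp}(\mathcal F)$. Corollary. Let $\mathcal F$ be an extremely sparse fusion system on the finite $p$-group $P$, and let $A\le\mathrm{Aut}_{\mathcal F}(P)$ be a $p'$-group of $\mathcal F$-automorphisms of $P$ such that $\mathcal F=\mathcal F_P(P\rtimes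 A)$. Then: 1. For every proper subgroup $Q<P$, $N_A(Q)=C_A(Q)$; that is, every element of $A$ that maps $Q$ onto itself fixes $Q$ pointwise. 2. $[P,\mathcal F]=P$. 3. $O^p(\mathcal F)=\mathcal F$; that is, $\mathcal F$ is a saturated subsystem of $\mathcal F$ of $p$-power index on $\mathfrak{hyp}(\mathcal F)$, and it is the only one. -/

import Mathlib

open scoped Pointwise

/-- A (not necessarily saturated) fusion system on the subgroup `base` of a group `P`.
Its objects are the subgroups of `base`; `Hom Q R` is the set of morphisms from `Q` to `R`
(empty unless `Q` and `R` are contained in `base`), and composition is composition of group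
homomorphisms. Working inside a fixed group `P` lets fusion systems on different subgroups of `P`
be compared. A fusion system on `P` itself is one with `base = ⊤`. -/
@[ext]
structure FusionSystem (P : Type*) [Group P] where
  base : Subgroup P
  Hom : (Q R : Subgroup P) → Set (Q →* R)
  dom_le : ∀ {Q R : Subgroup P} {φ : Q →* R}, φ ∈ Hom Q R → Q ≤ base
  cod_le : ∀ {Q R : Subgroup P} {φ : Q →* R}, φ ∈ Hom Q R → R ≤ base
  injective : ∀ {Q R : Subgroup P} {φ : Q →* R}, φ ∈ Hom Q R → Function.Injective φ
  comp_mem : ∀ {Q R T : Subgroup P} {φ : Q →* R} {ψ : R →* T},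
    φ ∈ Hom Q R → ψ ∈ Hom R T → ψ.comp φ ∈ Hom Q T
  /-- inclusions (in particular identities) are morphisms -/
  inclusion_mem : ∀ {Q R : Subgroup P} (h : Q ≤ R), R ≤ base → Subgroup.inclusion h ∈ Hom Q R
  /-- the isomorphism onto the image induced by a morphism is a morphism -/
  iso_mem : ∀ {Q R : Subgroup P} {φ : Q →* R}, φ ∈ Hom Q R →
    (R.subtype.comp φ).rangeRestrict ∈ Hom Q (R.subtype.comp φ).range
  /-- the inverse of the isomorphism onto the image induced by a morphism is a morphism -/
  iso_symm_mem : ∀ {Q R : Subgroup P} {φ : Q →* R} (hφ : φ ∈ Hom Q R),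
    ((MonoidHom.ofInjective (f := R.subtype.comp φ)
      (R.subtype_injective.comp (injective hφ))).symm : (R.subtype.comp φ).range →* Q)
        ∈ Hom (R.subtype.comp φ).range Q
  /-- conjugation maps by elements of `base` are morphisms -/
  conj_mem : ∀ {Q R : Subgroup P} (φ : Q →* R), Q ≤ base → R ≤ base →
    (∃ g ∈ base, ∀ x : Q, (φ x : P) = g * x * g⁻¹) → φ ∈ Hom Q R

namespace FusionSystem

variable {P : Type*} [Group P]

/-- `F_S(H)`: the fusion system on a subgroup `S` of `P` given by conjugation in a group `H`
containing `S`. Here `H` is a subgroup of `G`, and `P` is embedded in `G` by `ι`. -/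
def ofGroup {G : Type*} [Group G] (S : Subgroup P) (ι : P →* G) (hι : Function.Injective ι)
    (H : Subgroup G) (hS : S.map ι ≤ H) : FusionSystem P where
  base := S
  Hom Q R := {φ | Q ≤ S ∧ R ≤ S ∧ ∃ h ∈ H, ∀ x : Q, ι (φ x) = h * ι x * h⁻¹}
  dom_le h := h.1
  cod_le h := h.2.1
  injective := by
    rintro Q R φ ⟨-, -, h, -, hh⟩ x y hxy
    have h1 : h * ι x * h⁻¹ = h * ι y * h⁻¹ := by rw [← hh, ← hh, hxy]
    exact Subtype.ext (hι (mul_left_cancel (mul_right_cancel h1)))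
  comp_mem := by
    rintro Q R T φ ψ ⟨hQ, -, h, hH, hh⟩ ⟨-, hT, k, kH, hk⟩
    refine ⟨hQ, hT, k * h, H.mul_mem kH hH, fun x => ?_⟩
    rw [MonoidHom.comp_apply, hk, hh]
    group
  inclusion_mem := by
    intro Q R h hR
    exact ⟨h.trans hR, hR, 1, H.one_mem, fun x => by simp⟩
  iso_mem := by
    rintro Q R φ ⟨hQ, hR, h, hH, hh⟩
    refine ⟨hQ, ?_, h, hH, fun x => hh x⟩
    rintro _ ⟨x, rfl⟩
    exact hR (φ x).2
  iso_symm_mem := by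
    intro Q R φ hφ
    obtain ⟨hQ, hR, h, hH, hh⟩ := id hφ
    refine ⟨?_, hQ, h⁻¹, H.inv_mem hH, ?_⟩
    · rintro _ ⟨x, rfl⟩
      exact hR (φ x).2
    · intro y
      generalize_proofs _ hinj
      obtain ⟨x, rfl⟩ := (MonoidHom.ofInjective hinj).surjective y
      have := hh x
      rw [MonoidHom.coe_coe, MulEquiv.symm_apply_apply, MonoidHom.ofInjective_apply,
        MonoidHom.comp_apply, Subgroup.coe_subtype, this]
      group
  conj_mem := by
    rintro Q R φ hQ hR ⟨g, hg, h⟩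
    exact ⟨hQ, hR, ι g, hS ⟨g, hg, rfl⟩, fun x => by simp [h]⟩

/-- `F_S(S)`, the trivial fusion system on the subgroup `S` of `P`. -/
def trivialOn (S : Subgroup P) : FusionSystem P :=
  ofGroup S (MonoidHom.id P) Function.injective_id S (by simp)

/-- `F_P(P ⋊ A)` for a group `A` of automorphisms of `P`. -/
def ofSemidirect (A : Subgroup (MulAut P)) : FusionSystem P :=
  ofGroup (G := P ⋊[A.subtype] A) ⊤ SemidirectProduct.inl SemidirectProduct.inl_injective ⊤ le_top

/-- `G ≤ F`: `G` is a subcategory of `F`. -/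
instance : LE (FusionSystem P) where
  le G F := G.base ≤ F.base ∧ ∀ Q R : Subgroup P, G.Hom Q R ⊆ F.Hom Q R

/-- `Aut_F(Q)`. -/
def aut (F : FusionSystem P) (Q : Subgroup P) (hQ : Q ≤ F.base) : Subgroup (MulAut Q) where
  carrier := {α | (α : Q →* Q) ∈ F.Hom Q Q}
  one_mem' := F.inclusion_mem le_rfl hQ
  mul_mem' ha hb := F.comp_mem hb ha
  inv_mem' := by
    intro α hα
    have hr : Q = (Q.subtype.comp (α : Q →* Q)).range := by
      ext x
      constructor
      · intro hx
        exact ⟨α.symm ⟨x, hx⟩, by simp⟩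
      · rintro ⟨y, rfl⟩
        exact (α y).2
    have h1 := F.comp_mem
      (F.inclusion_mem hr.le (F.cod_le (F.iso_mem hα))) (F.iso_symm_mem hα)
    have he : ((α⁻¹ : MulAut Q) : Q →* Q) =
        ((MonoidHom.ofInjective (f := Q.subtype.comp (α : Q →* Q))
          (Q.subtype_injective.comp (F.injective hα))).symm : _ →* Q).comp
            (Subgroup.inclusion hr.le) := by
      refine MonoidHom.ext fun x => α.injective (Subtype.ext ?_)
      have := congrArg Subtype.val ((MonoidHom.ofInjective (f := Q.subtype.comp (α : Q →* Q))
        (Q.subtype_injective.comp (F.injective hα))).apply_symm_apply (Subgroup.inclusion hr.le x))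
      rw [MonoidHom.coe_coe, MulAut.apply_inv_self]
      exact this.symm
    change ((α⁻¹ : MulAut Q) : Q →* Q) ∈ F.Hom Q Q
    rw [he]
    exact h1

/-- `Aut_S(Q)`: the automorphisms of `Q` induced by conjugation with elements of `S`. -/
def conjAut (S Q : Subgroup P) : Subgroup (MulAut Q) where
  carrier := {α | ∃ g ∈ S, ∀ x : Q, (α x : P) = g * x * g⁻¹}
  one_mem' := ⟨1, S.one_mem, fun x => by simp⟩
  mul_mem' := by
    rintro α β ⟨g, hg, h⟩ ⟨k, hk, h'⟩
    exact ⟨g * k, S.mul_mem hg hk, fun x => by rw [MulAut.mul_apply, h, h']; group⟩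
  inv_mem' := by
    rintro α ⟨g, hg, h⟩
    refine ⟨g⁻¹, S.inv_mem hg, fun x => ?_⟩
    have := h (α⁻¹ x)
    rw [MulAut.apply_inv_self] at this
    rw [this]
    group

/-- `R` belongs to the `F`-isomorphism class of `Q`. (Inverses of bijective morphisms are
morphisms.) -/
def IsConj (F : FusionSystem P) (Q R : Subgroup P) : Prop :=
  ∃ φ ∈ F.Hom Q R, Function.Bijective φ

/-- `N_S(Q)`, where `S` is the group on which `F` lives. -/
def baseNormalizer (F : FusionSystem P) (Q : Subgroup P) : Subgroup P :=
  F.base ⊓ Subgroup.normalizer (Q : Set P)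

/-- `Q` is fully `F`-normalized. -/
def IsFullyNormalized (F : FusionSystem P) (Q : Subgroup P) : Prop :=
  ∀ R : Subgroup P, F.IsConj Q R → Nat.card (F.baseNormalizer R) ≤ Nat.card (F.baseNormalizer Q)

/-- The image `φ(Q)`, as a subgroup of `P`. -/
def image {Q R : Subgroup P} (φ : Q →* R) : Subgroup P := (R.subtype.comp φ).range

/-- `N_φ`: the elements `g` of `N_S(Q)` such that `φ ∘ c_g ∘ φ⁻¹` is conjugation on `φ(Q)` by
some element `h` of `N_S(φ(Q))`. -/
def extender (F : FusionSystem P) {Q R : Subgroup P} (φ : Q →* R) : Subgroup P where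
  carrier := {g | g ∈ F.baseNormalizer Q ∧ ∃ h ∈ F.baseNormalizer (image φ), ∀ x y : Q,
    (y : P) = g * x * g⁻¹ → (φ y : P) = h * φ x * h⁻¹}
  one_mem' := by
    refine ⟨Subgroup.one_mem _, 1, Subgroup.one_mem _, fun x y h => ?_⟩
    have : y = x := Subtype.ext (by simpa using h)
    simp [this]
  mul_mem' := by
    rintro a b ⟨ha, h, hh, h1⟩ ⟨hb, k, hk, h2⟩
    refine ⟨Subgroup.mul_mem _ ha hb, h * k, Subgroup.mul_mem _ hh hk, fun x y hy => ?_⟩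
    have hz : b * x * b⁻¹ ∈ Q := (Subgroup.mem_normalizer_iff.1 hb.2 x).1 x.2
    rw [h1 ⟨_, hz⟩ y (by rw [hy]; group), h2 x ⟨_, hz⟩ rfl]
    group
  inv_mem' := by
    rintro a ⟨ha, h, hh, h1⟩
    refine ⟨Subgroup.inv_mem _ ha, h⁻¹, Subgroup.inv_mem _ hh, fun x y hy => ?_⟩
    rw [h1 y x (by rw [hy]; group)]
    group

/-- `F` is saturated: the Sylow axiom and the extension axiom. -/
structure IsSaturated (p : ℕ) (F : FusionSystem P) : Prop where
  sylow : ∃ T : Sylow p (F.aut F.base le_rfl),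
    (T : Subgroup (F.aut F.base le_rfl)).map (F.aut F.base le_rfl).subtype =
      conjAut F.base F.base
  extension : ∀ (Q : Subgroup P) (φ : Q →* F.base), φ ∈ F.Hom Q F.base →
    F.IsFullyNormalized (image φ) →
    ∃ ψ ∈ F.Hom (F.extender φ) F.base,
      ∀ (x : Q) (y : F.extender φ), (y : P) = x → ψ y = φ x

/-- `F` is a nontrivial saturated fusion system whose only proper saturated subsystem on any
subgroup `Q` is `F_Q(Q)`. -/
structure IsExtremelySparse (p : ℕ) (F : FusionSystem P) : Prop where
  saturated : F.IsSaturated p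
  nontrivial : F ≠ trivialOn F.base
  eq_trivialOn : ∀ G : FusionSystem P, G ≤ F → G.IsSaturated p → G ≠ F → G = trivialOn G.base

/-- The focal subgroup `⟨x⁻¹ φ(x) | x ∈ S, φ ∈ Hom_F(⟨x⟩, S)⟩` of a fusion system `F` on `S`. -/
def focal (F : FusionSystem P) : Subgroup P :=
  Subgroup.closure {y | ∃ x ∈ F.base, ∃ φ ∈ F.Hom (Subgroup.zpowers x) F.base,
    y = x⁻¹ * φ ⟨x, Subgroup.mem_zpowers x⟩}

/-- `O^p(K)` for a finite group `K`: the smallest normal subgroup of `p`-power index. -/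
def pResidual (p : ℕ) (K : Type*) [Group K] : Subgroup K :=
  sInf {N | N.Normal ∧ ∃ k : ℕ, N.index = p ^ k}

/-- `O^p(Aut_F(Q))`, as a group of automorphisms of `Q`. -/
def autResidual (p : ℕ) (F : FusionSystem P) (Q : Subgroup P) (hQ : Q ≤ F.base) :
    Subgroup (MulAut Q) :=
  (pResidual p (F.aut Q hQ)).map (F.aut Q hQ).subtype

/-- The hyperfocal subgroup `⟨x⁻¹ α(x) | x ∈ Q ≤ S, α ∈ O^p(Aut_F(Q))⟩` of a fusion system `F`
on `S`. -/
def hyperfocal (p : ℕ) (F : FusionSystem P) : Subgroup P :=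
  Subgroup.closure {y | ∃ (Q : Subgroup P) (hQ : Q ≤ F.base), ∃ α ∈ F.autResidual p Q hQ,
    ∃ x : Q, y = (x : P)⁻¹ * α x}

/-- `G` is a saturated subsystem of `F` of `p`-power index. -/
structure HasPPowerIndex (p : ℕ) (F G : FusionSystem P) : Prop where
  le : G ≤ F
  saturated : G.IsSaturated p
  hyperfocal_le : F.hyperfocal p ≤ G.base
  autResidual_le : ∀ (Q : Subgroup P) (hF : Q ≤ F.base) (hG : Q ≤ G.base),
    F.autResidual p Q hF ≤ G.aut Q hG

/-- `G` is (the) saturated subsystem of `p`-power index of `F` on the hyperfocal subgroup of `F`,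
the property that defines `O^p(F)`. -/
def IsOp (p : ℕ) (F G : FusionSystem P) : Prop :=
  F.HasPPowerIndex p G ∧ G.base = F.hyperfocal p

end FusionSystem

/-! For `Q < P` the subsystem F_Q(Q ⋊ N_A(Q)) is saturated, and it differs from F because it lives
on `Q`; sparseness makes it trivial. So each `a` in N_A(Q) acts on `Q` as conjugation by an element
of `Q`, and a p'-automorphism acting like a p-element acts trivially
(`stabilizer_eq_fixingSubgroup`).

Since F is nontrivial, some `a ≠ 1` lies in `A`. The subgroup [P, a] is `a`-invariant; were it
proper, `a` would centralize it, and coprimality would force `a = 1`. Hence [P, a] = P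
(`closure_commutators_eq_top`), which makes both the focal and the hyperfocal subgroup all of `P`. A
subsystem of p-power index on `P` contains `a`; if it were not F it would be trivial, making `a`
inner and therefore 1. -/

theorem mem_of_pow_mem_of_coprime {G : Type*} [Group G] (H : Subgroup G) {a : G} {m n : ℕ}
    (ha : a ^ m = 1) (hmn : m.Coprime n) (hn : a ^ n ∈ H) : a ∈ H := by
  have h := Int.gcd_eq_gcd_ab (m : ℤ) n
  rw [Int.gcd_natCast_natCast, hmn.gcd_eq_one] at h
  have h1 : a = (a ^ n) ^ (Int.gcdB (m : ℤ) n) := by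
    conv_lhs => rw [← zpow_one a, ← Nat.cast_one (R := ℤ), h, zpow_add, zpow_mul, zpow_mul,
      zpow_natCast, zpow_natCast, ha, one_zpow, one_mul]
  rw [h1]
  exact H.zpow_mem hn _

namespace FusionSystem

variable {P : Type*} [Group P]

/-! ### The subsystems F_Q(Q ⋊ N_A(Q)) and their saturation. -/

theorem mem_stabilizer_iff_map {A : Subgroup (MulAut P)} {Q : Subgroup P} {a : A} :
    a ∈ MulAction.stabilizer A Q ↔ Q.map ((a : MulAut P) : P →* P) = Q :=
  Iff.rfl

theorem apply_mem_of_mem_stabilizer {A : Subgroup (MulAut P)} {Q : Subgroup P} {a : A}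
    (ha : a ∈ MulAction.stabilizer A Q) {x : P} (hx : x ∈ Q) : (a : MulAut P) x ∈ Q :=
  (mem_stabilizer_iff_map.1 ha).le ⟨x, hx, rfl⟩

/-- The subgroup `Q ⋊ N_A(Q)` of `P ⋊ A`. -/
def semidirectStabilizer (A : Subgroup (MulAut P)) (Q : Subgroup P) :
    Subgroup (P ⋊[A.subtype] A) where
  carrier := {h | h.left ∈ Q ∧ h.right ∈ MulAction.stabilizer A Q}
  one_mem' := ⟨Q.one_mem, Subgroup.one_mem _⟩
  mul_mem' := by
    rintro g h ⟨g1, g2⟩ ⟨h1, h2⟩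
    exact ⟨Q.mul_mem g1 (apply_mem_of_mem_stabilizer g2 h1), Subgroup.mul_mem _ g2 h2⟩
  inv_mem' := by
    rintro g ⟨g1, g2⟩
    have g3 := Subgroup.inv_mem _ g2
    exact ⟨apply_mem_of_mem_stabilizer g3 (Q.inv_mem g1), g3⟩

theorem map_inl_le_semidirectStabilizer (A : Subgroup (MulAut P)) (Q : Subgroup P) :
    Q.map SemidirectProduct.inl ≤ semidirectStabilizer A Q := by
  rintro _ ⟨x, hx, rfl⟩
  exact ⟨hx, Subgroup.one_mem _⟩

/-- `F_Q(Q ⋊ N_A(Q))`. -/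
def ofStabilizer (A : Subgroup (MulAut P)) (Q : Subgroup P) : FusionSystem P :=
  ofGroup Q SemidirectProduct.inl SemidirectProduct.inl_injective (semidirectStabilizer A Q)
    (map_inl_le_semidirectStabilizer A Q)

theorem semidirect_conj_inl (A : Subgroup (MulAut P)) (h : P ⋊[A.subtype] A) (x : P) :
    h * SemidirectProduct.inl x * h⁻¹ =
      SemidirectProduct.inl (h.left * (h.right : MulAut P) x * h.left⁻¹) := by
  ext <;> simp

theorem mem_ofStabilizer_hom {A : Subgroup (MulAut P)} {Q R T : Subgroup P} {φ : R →* T} :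
    φ ∈ (ofStabilizer A Q).Hom R T ↔ R ≤ Q ∧ T ≤ Q ∧ ∃ g ∈ Q, ∃ a ∈ MulAction.stabilizer A Q,
      ∀ x : R, (φ x : P) = g * (a : MulAut P) x * g⁻¹ := by
  constructor
  · rintro ⟨h1, h2, h, ⟨hl, hr⟩, hh⟩
    refine ⟨h1, h2, h.left, hl, h.right, hr, fun x => ?_⟩
    have := hh x
    rw [semidirect_conj_inl] at this
    exact SemidirectProduct.inl_injective this
  · rintro ⟨h1, h2, g, hg, a, ha, hh⟩
    refine ⟨h1, h2, ⟨g, a⟩, ⟨hg, ha⟩, fun x => ?_⟩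
    rw [semidirect_conj_inl, hh]

/-- Modulo inner automorphisms of `Q`, every automorphism in the system comes from the p'-group
N_A(Q), so Inn(Q) is Sylow. Every morphism is a restriction of some c_g ∘ a preserving `Q`, so it
extends to any subgroup of `Q`. -/
theorem isSaturated_ofStabilizer {p : ℕ} [Fact p.Prime] [Finite P] (hP : IsPGroup p P)
    (A : Subgroup (MulAut P)) (hA : ¬ p ∣ Nat.card A) (Q : Subgroup P) :
    (ofStabilizer A Q).IsSaturated p where
  sylow := by
    have hle : conjAut Q Q ≤ (ofStabilizer A Q).aut Q le_rfl := fun α ⟨g, hg, h⟩ =>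
      (ofStabilizer A Q).conj_mem _ le_rfl le_rfl ⟨g, hg, h⟩
    set K := (ofStabilizer A Q).aut Q le_rfl with hK
    set I : Subgroup K := (conjAut Q Q).subgroupOf K with hI
    have hIp : IsPGroup p I := by
      rintro ⟨⟨α, hα⟩, g, hg, h⟩
      obtain ⟨k, hk⟩ := hP g
      refine ⟨k, Subtype.ext (Subtype.ext ?_)⟩
      have h' : ∀ (n : ℕ) (x : Q), ((α ^ n) x : P) = g ^ n * x * (g ^ n)⁻¹ := by
        intro n
        induction n with
        | zero => simp
        | succ n ih =>
          intro x
          rw [pow_succ' α, MulAut.mul_apply, pow_succ' g]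
          have := h ((α ^ n) x)
          simp only [Subgroup.coe_subtype] at this
          rw [this, ih]
          group
      refine MulEquiv.ext fun x => Subtype.ext ?_
      have := h' (p ^ k) x
      rw [hk] at this
      simpa using this
    have hnorm : I.Normal := by
      constructor
      rintro ⟨α, hα⟩ ⟨g, hg, h⟩ ⟨β, hβ⟩
      refine ⟨β ⟨g, hg⟩, (β ⟨g, hg⟩).2, fun x => ?_⟩
      have h1 : α (β⁻¹ x) = ⟨g, hg⟩ * β⁻¹ x * ⟨g, hg⟩⁻¹ := Subtype.ext (h _)
      change ((β (α (β⁻¹ x)) : Q) : P) = _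
      rw [h1]
      simp
    -- By Cauchy, `p ∣ I.index` would give a class of order `p` modulo `I`; but the `Nat.card A`-th
    -- power of each class is trivial, so `p` would divide `Nat.card A`.
    have hindex : ¬ p ∣ I.index := by
      intro hp
      rw [Subgroup.index_eq_card] at hp
      obtain ⟨y, hy⟩ := exists_prime_orderOf_dvd_card' p hp
      obtain ⟨⟨α, hα⟩, rfl⟩ := QuotientGroup.mk_surjective y
      obtain ⟨-, -, g, hg, a, ha, h⟩ := mem_ofStabilizer_hom.1 hα
      have hpow : ∀ n : ℕ, ∃ g ∈ Q, ∀ x : Q,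
          ((α ^ n) x : P) = g * ((a : MulAut P) ^ n) x * g⁻¹ := by
        intro n
        induction n with
        | zero => exact ⟨1, Q.one_mem, by simp⟩
        | succ n ih =>
          obtain ⟨k, hk, ih⟩ := ih
          refine ⟨g * (a : MulAut P) k, Q.mul_mem hg (apply_mem_of_mem_stabilizer ha hk),
            fun x => ?_⟩
          rw [pow_succ' α, MulAut.mul_apply, pow_succ' (a : MulAut P), MulAut.mul_apply]
          have := h ((α ^ n) x)
          simp only [MonoidHom.coe_coe] at this
          rw [this, ih]
          simp [mul_assoc]
      obtain ⟨k, hk, hm⟩ := hpow (Nat.card A)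
      have ham : (a : MulAut P) ^ Nat.card A = 1 := by
        rw [← Subgroup.coe_pow, pow_card_eq_one', Subgroup.coe_one]
      have hmem : (⟨α, hα⟩ : K) ^ Nat.card A ∈ I := ⟨k, hk, fun x => by
        have := hm x
        rw [ham] at this
        exact this⟩
      rw [← QuotientGroup.eq_one_iff, QuotientGroup.mk_pow] at hmem
      have := orderOf_dvd_of_pow_eq_one hmem
      rw [hy] at this
      exact hA this
    refine ⟨hIp.toSylow hindex, ?_⟩
    exact Subgroup.map_subgroupOf_eq_of_le hle
  extension := by
    intro R φ hφ _
    obtain ⟨hR, -, g, hg, a, ha, h⟩ := mem_ofStabilizer_hom.1 hφ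
    have hE : (ofStabilizer A Q).extender φ ≤ Q := fun x hx => hx.1.1
    let ψ : (ofStabilizer A Q).extender φ →* (ofStabilizer A Q).base :=
      (((MulAut.conj g * (a : MulAut P) : MulAut P) : P →* P).comp
        (Subgroup.subtype _)).codRestrict _ fun x =>
          Q.mul_mem (Q.mul_mem hg (apply_mem_of_mem_stabilizer ha (hE x.2))) (Q.inv_mem hg)
    refine ⟨ψ, mem_ofStabilizer_hom.2 ⟨hE, le_rfl, g, hg, a, ha, fun x => rfl⟩, ?_⟩
    intro x y hxy
    refine Subtype.ext ?_
    rw [h x, ← hxy]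
    rfl

theorem mem_ofSemidirect_hom {A : Subgroup (MulAut P)} {R T : Subgroup P} {φ : R →* T} :
    φ ∈ (ofSemidirect A).Hom R T ↔ ∃ g : P, ∃ a ∈ A,
      ∀ x : R, (φ x : P) = g * (a : MulAut P) x * g⁻¹ := by
  constructor
  · rintro ⟨-, -, h, -, hh⟩
    refine ⟨h.left, h.right, h.right.2, fun x => ?_⟩
    have := hh x
    rw [semidirect_conj_inl] at this
    exact SemidirectProduct.inl_injective this
  · rintro ⟨g, a, ha, hh⟩
    refine ⟨le_top, le_top, ⟨g, ⟨a, ha⟩⟩, trivial, fun x => ?_⟩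
    rw [semidirect_conj_inl, hh]

theorem ofStabilizer_le_ofSemidirect (A : Subgroup (MulAut P)) (Q : Subgroup P) :
    ofStabilizer A Q ≤ ofSemidirect A := by
  refine ⟨le_top, fun R T φ hφ => ?_⟩
  obtain ⟨-, -, g, -, a, -, h⟩ := mem_ofStabilizer_hom.1 hφ
  exact mem_ofSemidirect_hom.2 ⟨g, a, a.2, h⟩

theorem ofSemidirect_bot : ofSemidirect (⊥ : Subgroup (MulAut P)) = trivialOn ⊤ := by
  refine FusionSystem.ext rfl ?_
  funext R T
  ext φ
  rw [mem_ofSemidirect_hom]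
  constructor
  · rintro ⟨g, a, ha, h⟩
    obtain rfl := Subgroup.mem_bot.1 ha
    exact ⟨le_top, le_top, g, trivial, h⟩
  · rintro ⟨-, -, g, -, h⟩
    exact ⟨g, 1, Subgroup.one_mem _, h⟩

/-! ### Rigidity of p'-automorphisms under sparseness. -/

/-- A `p'`-automorphism of a `p`-group that agrees on `Q` with an inner automorphism
of `P` fixes `Q` pointwise. -/
theorem apply_eq_of_eq_conj {p : ℕ} (hp : p.Prime) (hP : IsPGroup p P) {a : MulAut P} {m : ℕ}
    (hm : a ^ m = 1) (hpm : ¬ p ∣ m) {Q : Subgroup P} (hQ : ∀ x ∈ Q, a x ∈ Q) {g : P}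
    (h : ∀ x ∈ Q, a x = g * x * g⁻¹) : ∀ x ∈ Q, a x = x := by
  obtain ⟨k, hk⟩ := hP g
  have hpow : ∀ n : ℕ, ∀ x ∈ Q, (a ^ n) x = g ^ n * x * (g ^ n)⁻¹ := by
    intro n
    induction n with
    | zero => simp
    | succ n ih =>
      intro x hx
      rw [pow_succ, MulAut.mul_apply, ih _ (hQ x hx), h x hx]
      group
  -- On `Q` this power is conjugation by `g ^ p ^ k = 1`; since `p ^ k` is prime to `m`, `a` itself
  -- is a power of it.
  have hmem : a ^ p ^ k ∈ fixingSubgroup (MulAut P) (Q : Set P) := by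
    rw [mem_fixingSubgroup_iff]
    intro x hx
    have := hpow (p ^ k) x hx
    rwa [hk, one_mul, inv_one, mul_one] at this
  have := mem_of_pow_mem_of_coprime _ hm
    (((Nat.Prime.coprime_iff_not_dvd hp).2 hpm).symm.pow_right k) hmem
  exact (mem_fixingSubgroup_iff _).1 this

theorem stabilizer_eq_fixingSubgroup {p : ℕ} [Fact p.Prime] [Finite P] (hP : IsPGroup p P)
    {A : Subgroup (MulAut P)} (hA : ¬ p ∣ Nat.card A) (hF : (ofSemidirect A).IsExtremelySparse p)
    {Q : Subgroup P} (hQ : Q < ⊤) :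
    MulAction.stabilizer A Q = fixingSubgroup A (Q : Set P) := by
  apply le_antisymm
  · intro a ha
    have htriv := hF.eq_trivialOn (ofStabilizer A Q) (ofStabilizer_le_ofSemidirect A Q)
      (isSaturated_ofStabilizer hP A hA Q) fun h => hQ.ne (congrArg base h)
    let φ : Q →* Q := (((a : MulAut P) : P →* P).comp Q.subtype).codRestrict Q
      fun x => apply_mem_of_mem_stabilizer ha x.2
    have hφ : φ ∈ (ofStabilizer A Q).Hom Q Q :=
      mem_ofStabilizer_hom.2 ⟨le_rfl, le_rfl, 1, Q.one_mem, a, ha, fun x => by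
        rw [one_mul, inv_one, mul_one]; rfl⟩
    rw [htriv] at hφ
    obtain ⟨-, -, g, -, h⟩ := hφ
    rw [mem_fixingSubgroup_iff]
    exact apply_eq_of_eq_conj (m := Nat.card A) Fact.out hP
      (by rw [← Subgroup.coe_pow, pow_card_eq_one', Subgroup.coe_one]) hA
      (fun x hx => apply_mem_of_mem_stabilizer ha hx) (g := g) fun x hx => h ⟨x, hx⟩
  · intro a ha
    rw [mem_fixingSubgroup_iff] at ha
    rw [mem_stabilizer_iff_map]
    ext x
    constructor
    · rintro ⟨y, hy, rfl⟩
      have : (a : MulAut P) y = y := ha y hy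
      exact this.symm ▸ hy
    · exact fun hx => ⟨x, hx, ha x hx⟩

/-- For a nontrivial `p'`-automorphism `a` in an extremely sparse `P ⋊ A`, `[P, a] = P`. -/
theorem closure_commutators_eq_top {p : ℕ} [Fact p.Prime] [Finite P] (hP : IsPGroup p P)
    {A : Subgroup (MulAut P)} (hA : ¬ p ∣ Nat.card A) (hF : (ofSemidirect A).IsExtremelySparse p)
    {a : MulAut P} (haA : a ∈ A) (ha : a ≠ 1) :
    Subgroup.closure {y | ∃ x : P, y = x⁻¹ * a x} = ⊤ := by
  by_contra hne
  set H := Subgroup.closure {y | ∃ x : P, y = x⁻¹ * a x} with hH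
  -- The image of the generator at `x` is the generator at `a x`.
  have hmap : H.map (a : P →* P) ≤ H := by
    rw [hH, MonoidHom.map_closure, Subgroup.closure_le]
    rintro _ ⟨_, ⟨x, rfl⟩, rfl⟩
    exact Subgroup.subset_closure ⟨a x, by simp⟩
  have hstab : (⟨a, haA⟩ : A) ∈ MulAction.stabilizer A H := by
    rw [mem_stabilizer_iff_map]
    refine Subgroup.eq_of_le_of_card_ge hmap ?_
    exact (Nat.card_congr (H.equivMapOfInjective (a : P →* P) a.injective).toEquiv).le
  rw [stabilizer_eq_fixingSubgroup hP hA hF (lt_top_iff_ne_top.2 hne),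
    mem_fixingSubgroup_iff] at hstab
  have hfix : ∀ y ∈ H, a y = y := hstab
  refine ha (MulEquiv.ext fun x => ?_)
  set c := x⁻¹ * a x with hc
  have hcH : c ∈ H := Subgroup.subset_closure ⟨x, rfl⟩
  -- Because `a` fixes `c`. Taking `n = Nat.card A` gives `c ^ n = 1`, and `c` is a p-element, so `c
  -- = 1`.
  have hpow : ∀ n : ℕ, (a ^ n) x = x * c ^ n := by
    intro n
    induction n with
    | zero => simp
    | succ n ih =>
      rw [pow_succ', MulAut.mul_apply, ih, map_mul, map_pow, hfix c hcH, pow_succ', ← mul_assoc,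
        hc, mul_inv_cancel_left]
  have ham : a ^ Nat.card A = 1 := by
    have := congrArg Subtype.val (pow_card_eq_one' (x := (⟨a, haA⟩ : A)))
    exact this
  have hcm : c ^ Nat.card A = 1 := by
    have := hpow (Nat.card A)
    rw [ham] at this
    exact (mul_eq_left.1 this.symm)
  obtain ⟨k, hk⟩ := hP c
  have h1 : c ∈ (⊥ : Subgroup P) := mem_of_pow_mem_of_coprime ⊥ hcm
    (((Nat.Prime.coprime_iff_not_dvd Fact.out).2 hA).symm.pow_right k) (Subgroup.mem_bot.2 hk)
  exact (inv_mul_eq_one.1 (Subgroup.mem_bot.1 h1)).symm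

/-! ### Focal and hyperfocal subgroups, and O^p(F). -/

/-- A p'-element dies in every quotient of p-power order. This puts the action of `A` on `P` inside
O^p(Aut_F(P)). -/
theorem mem_pResidual {p : ℕ} (hp : p.Prime) {K : Type*} [Group K] {x : K} {m : ℕ}
    (hx : x ^ m = 1) (hm : ¬ p ∣ m) : x ∈ pResidual p K := by
  rw [pResidual, Subgroup.mem_sInf]
  rintro N ⟨hN, k, hk⟩
  refine mem_of_pow_mem_of_coprime N hx
    (((Nat.Prime.coprime_iff_not_dvd hp).2 hm).symm.pow_right k) ?_
  rw [← hk]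
  exact Subgroup.pow_index_mem N x

/-- The restriction to `⊤ ≤ P` of an automorphism of `P`. -/
def autTop (a : MulAut P) : MulAut (⊤ : Subgroup P) :=
  MulAut.congr Subgroup.topEquiv.symm a

theorem autTop_mem_autResidual {p : ℕ} [Fact p.Prime] {A : Subgroup (MulAut P)}
    (hA : ¬ p ∣ Nat.card A) {a : MulAut P} (ha : a ∈ A) :
    autTop a ∈ (ofSemidirect A).autResidual p ⊤ le_rfl := by
  have hmem : autTop a ∈ (ofSemidirect A).aut ⊤ le_rfl :=
    mem_ofSemidirect_hom.2 ⟨1, a, ha, fun x => by simp [autTop]⟩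
  refine ⟨⟨autTop a, hmem⟩, mem_pResidual Fact.out (m := Nat.card A) (Subtype.ext ?_) hA, rfl⟩
  have ham : a ^ Nat.card A = 1 := congrArg Subtype.val (pow_card_eq_one' (x := (⟨a, ha⟩ : A)))
  change autTop a ^ Nat.card A = 1
  rw [autTop, ← map_pow, ham, map_one]

theorem focal_ofSemidirect_eq_top {A : Subgroup (MulAut P)} {a : MulAut P} (ha : a ∈ A)
    (h : Subgroup.closure {y | ∃ x : P, y = x⁻¹ * a x} = ⊤) : (ofSemidirect A).focal = ⊤ := by
  rw [eq_top_iff, ← h]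
  refine Subgroup.closure_mono ?_
  rintro _ ⟨x, rfl⟩
  exact ⟨x, trivial, ((a : P →* P).comp (Subgroup.subtype _)).codRestrict _ fun _ => trivial,
    mem_ofSemidirect_hom.2 ⟨1, a, ha, fun y => by
      rw [one_mul, inv_one, mul_one]; rfl⟩, rfl⟩

theorem hyperfocal_ofSemidirect_eq_top {p : ℕ} [Fact p.Prime] {A : Subgroup (MulAut P)}
    (hA : ¬ p ∣ Nat.card A) {a : MulAut P} (ha : a ∈ A)
    (h : Subgroup.closure {y | ∃ x : P, y = x⁻¹ * a x} = ⊤) :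
    (ofSemidirect A).hyperfocal p = ⊤ := by
  rw [eq_top_iff, ← h]
  refine Subgroup.closure_mono ?_
  rintro _ ⟨x, rfl⟩
  exact ⟨⊤, le_rfl, autTop a, autTop_mem_autResidual hA ha, ⟨x, trivial⟩, rfl⟩

theorem isOp_ofSemidirect_iff {p : ℕ} [Fact p.Prime] (hP : IsPGroup p P)
    {A : Subgroup (MulAut P)} (hA : ¬ p ∣ Nat.card A) (hF : (ofSemidirect A).IsExtremelySparse p)
    {a : MulAut P} (ha : a ∈ A) (ha1 : a ≠ 1)
    (hhyp : (ofSemidirect A).hyperfocal p = ⊤) (G : FusionSystem P) :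
    (ofSemidirect A).IsOp p G ↔ G = ofSemidirect A := by
  constructor
  · rintro ⟨hG, hbase⟩
    by_contra hne
    have htriv := hF.eq_trivialOn G hG.le hG.saturated hne
    rw [hbase, hhyp] at htriv
    subst htriv
    -- The trivial system on `P` would have to contain `a`, so `a` is conjugation by some `g`,
    -- contradicting `a ≠ 1` by coprimality.
    obtain ⟨-, -, g, -, h⟩ := hG.autResidual_le ⊤ le_rfl le_rfl (autTop_mem_autResidual hA ha)
    have ham : a ^ Nat.card A = 1 := congrArg Subtype.val (pow_card_eq_one' (x := (⟨a, ha⟩ : A)))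
    exact ha1 (MulEquiv.ext fun x => apply_eq_of_eq_conj Fact.out hP ham hA (Q := ⊤)
      (fun _ _ => trivial) (g := g) (fun x hx => h ⟨x, hx⟩) x trivial)
  · rintro rfl
    refine ⟨⟨⟨le_rfl, fun _ _ => subset_rfl⟩, hF.saturated, le_top, fun Q hQ _ => ?_⟩, hhyp.symm⟩
    rintro _ ⟨β, -, rfl⟩
    exact β.2

end FusionSystem

theorem mainTheorem10 {p : ℕ} [Fact p.Prime] {P : Type*} [Group P] [Finite P] (hP : IsPGroup p P)
    (F : FusionSystem P) (hbase : F.base = ⊤) (hF : F.IsExtremelySparse p)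
    (A : Subgroup (MulAut P)) (hA : ¬ p ∣ Nat.card A)
    (hAF : ∀ α ∈ A, ∃ φ ∈ F.Hom ⊤ ⊤, ∀ x, (φ x : P) = α x)
    (hFA : F = FusionSystem.ofSemidirect A) :
    (∀ Q : Subgroup P, Q < ⊤ → MulAction.stabilizer A Q = fixingSubgroup A (Q : Set P)) ∧
    F.focal = ⊤ ∧
    (∀ G : FusionSystem P, F.IsOp p G ↔ G = F) := by
  subst hFA
  have hbot : A ≠ ⊥ := by
    rintro rfl
    exact hF.nontrivial FusionSystem.ofSemidirect_bot
  obtain ⟨a, ha, ha1⟩ := (Subgroup.bot_or_exists_ne_one A).resolve_left hbot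
  have htop := FusionSystem.closure_commutators_eq_top hP hA hF ha ha1
  exact ⟨fun Q hQ => FusionSystem.stabilizer_eq_fixingSubgroup hP hA hF hQ,
    FusionSystem.focal_ofSemidirect_eq_top ha htop,
    FusionSystem.isOp_ofSemidirect_iff hP hA hF ha ha1
      (FusionSystem.hyperfocal_ofSemidirect_eq_top hA ha htop)⟩
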